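/- There exists a set $T$ of topologies on $\mathbb{R}$ of cardinality exactly $\mathfrak{c}=2^{\aleph_0}$ such that every $\tau\in T$ is finer than (or equal to) the Euclidean topology and the space $(\mathbb{R},\tau)$ is connected, separable and completely metrizable, and such that the spaces $(\mathbb{R},\tau)$, $\tau\in T$, are incomparable: whenever $\tau,\sigma\in T$ and $(\mathbb{R},\tau)$ is homeomorphic to a subspace $S\subseteq\mathbb{R}$ of $(\mathbb{R},\sigma)$, then $\tau=\sigma$ and $S=\mathbb{R}$. (That is, distinct topologies in $T$ give non-homeomorphic spaces, and no space $(\mathbb{R},\tau)$ with $\tau\in T$ is homeomorphic to a proper subspace of itself or of any other $(\mathbb{R},\sigma)$ with $\sigma\in T$.) -/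

import Mathlib

/-- The spaces `(α, τ)`, for `τ` in the family `T` of topologies on `α`, are *incomparable*:
`(α, τ)` is homeomorphic to a subspace `S` of `(α, σ)` only in the trivial case where
`(α, τ)`, `S` and `(α, σ)` are all the same space. -/
def IncomparableTopologies {α : Type*} (T : Set (TopologicalSpace α)) : Prop :=
  ∀ τ ∈ T, ∀ σ ∈ T, ∀ S : Set α,
    Nonempty (@Homeomorph α S τ (TopologicalSpace.induced Subtype.val σ)) →
      τ = σ ∧ S = Set.univ

/-- The Euclidean topology on the real line (the standard one of Mathlib).
For a topology `τ`, the relation `τ ≤ euclideanTopology` says that `τ` is finer, that is,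
every Euclidean open set is `τ`-open. -/
abbrev euclideanTopology : TopologicalSpace ℝ := inferInstance

/-! Refine the line by making continuous a function `f` that vanishes on `ℤ`, is continuous off `ℤ`
and oscillates like `sin (π / u)` at chosen sides of integers. The topology is that of the graph:
Polish because the graph is `Gδ`, and connected as for the topologist's sine curve. All
order-connected sets stay connected, so an embedding between two such spaces is strictly monotone
with order-connected range. It preserves one-sided continuity of `f`; as every integer is singular
on some side, an increasing embedding restricts to a shift of `ℤ`, hence is onto
(`sineComb.exists_shift_of_strictMono`). The marks, coding `A ⊆ ℕ`, allow only the zero shift and no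
reversal (`codedTopology_rigid`). -/

open Set Filter Topology

/-! ### Polish graph topologies -/

/-- A `Gδ` subset of a Polish space is Polish. -/
theorem IsGδ.polishSpace_coe {X : Type*} [TopologicalSpace X] [PolishSpace X] {s : Set X}
    (hs : IsGδ s) : PolishSpace s := by
  obtain ⟨U, hU, rfl⟩ := isGδ_iff_eq_iInter_nat.1 hs
  have : ∀ n, PolishSpace (U n) := fun n => (hU n).polishSpace
  -- The diagonal map is a closed embedding into a countable product of Polish spaces.
  let F : (⋂ n, U n : Set X) → ∀ n, U n := fun x n => ⟨x.1, mem_iInter.1 x.2 n⟩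
  have hF : Continuous F :=
    continuous_pi fun n => continuous_subtype_val.subtype_mk _
  have hind : IsInducing F := by
    refine IsInducing.of_comp hF (g := fun w => (w 0).1)
      (continuous_subtype_val.comp (continuous_apply 0)) ?_
    exact IsInducing.subtypeVal
  have hinj : Function.Injective F := fun x y h =>
    Subtype.ext (congrArg (fun w : ∀ n, U n => (w 0).1) h)
  have hrange : range F = ⋂ n, {w : ∀ n, U n | (w n).1 = (w 0).1} := by
    ext w
    simp only [mem_range, mem_iInter, mem_ofPred_eq]
    constructor
    · rintro ⟨x, rfl⟩ n
      rfl
    · intro h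
      refine ⟨⟨(w 0).1, mem_iInter.2 fun n => h n ▸ (w n).2⟩, ?_⟩
      funext n
      exact Subtype.ext (h n).symm
  have hcl : IsClosed (range F) := by
    rw [hrange]
    exact isClosed_iInter fun n => isClosed_eq
      (continuous_subtype_val.comp (continuous_apply n))
      (continuous_subtype_val.comp (continuous_apply 0))
  exact IsClosedEmbedding.polishSpace ⟨⟨hind, hinj⟩, hcl⟩

/-- The coarsest topology on `ℝ` finer than the Euclidean one and making `f` continuous. -/
abbrev graphTopology (f : ℝ → ℝ) : TopologicalSpace ℝ :=
  TopologicalSpace.induced (fun x => (x, f x)) inferInstance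

theorem isInducing_graphTopology (f : ℝ → ℝ) :
    @IsInducing ℝ (ℝ × ℝ) (graphTopology f) _ (fun x => (x, f x)) :=
  @IsInducing.mk ℝ (ℝ × ℝ) (graphTopology f) _ _ rfl

theorem nhds_graphTopology (f : ℝ → ℝ) (x : ℝ) :
    @nhds ℝ (graphTopology f) x = 𝓝 x ⊓ comap f (𝓝 (f x)) := by
  rw [graphTopology, nhds_induced, nhds_prod_eq, comap_prod]
  congr 1
  exact comap_id

theorem graphTopology_le (f : ℝ → ℝ) : graphTopology f ≤ euclideanTopology := by
  refine le_of_nhds_le_nhds fun x => ?_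
  rw [nhds_graphTopology]
  exact inf_le_left

theorem tendsto_nhds_graphTopology {ι : Type*} {l : Filter ι} {u : ι → ℝ} {f : ℝ → ℝ} {x : ℝ} :
    Tendsto u l (@nhds ℝ (graphTopology f) x) ↔
      Tendsto u l (𝓝 x) ∧ Tendsto (fun i => f (u i)) l (𝓝 (f x)) := by
  rw [nhds_graphTopology, tendsto_inf, tendsto_comap_iff]
  rfl

theorem polishSpace_graphTopology {f : ℝ → ℝ} (hf : IsGδ (range fun x => (x, f x))) :
    @PolishSpace ℝ (graphTopology f) := by
  have := hf.polishSpace_coe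
  have he : @IsEmbedding ℝ (ℝ × ℝ) (graphTopology f) _ (fun x => (x, f x)) :=
    @IsEmbedding.mk ℝ (ℝ × ℝ) (graphTopology f) _ _ (isInducing_graphTopology f)
      fun x y h => congrArg Prod.fst h
  exact @IsClosedEmbedding.polishSpace _ _ (graphTopology f) _ _ _
    (@Homeomorph.isClosedEmbedding _ _ (graphTopology f) _
      (@IsEmbedding.toHomeomorph _ _ (graphTopology f) _ _ he))

/-- Off a closed set `Z` on which it vanishes, `f` is continuous; then its graph is `Gδ`. -/
theorem isGδ_range_graph {f : ℝ → ℝ} {Z : Set ℝ} (hZ : IsClosed Z) (hf0 : ∀ x ∈ Z, f x = 0)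
    (hf : ∀ x ∉ Z, ContinuousAt f x) : IsGδ (range fun x => (x, f x)) := by
  have h : (range fun x => (x, f x)) =
      {p : ℝ × ℝ | p.1 ∉ Z ∧ p.2 ≠ f p.1}ᶜ ∩ ({p | p.1 ∉ Z} ∪ {p | p.2 = 0}) := by
    ext ⟨x, y⟩
    by_cases hx : x ∈ Z <;> simp [hx, hf0, eq_comm]
  rw [h]
  refine (IsClosed.isGδ ?_).inter (IsGδ.union (IsOpen.isGδ ?_) (IsClosed.isGδ ?_))
  · rw [isClosed_compl_iff, isOpen_iff_mem_nhds]
    rintro ⟨x, y⟩ ⟨hx, hy⟩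
    have h1 : ∀ᶠ p : ℝ × ℝ in 𝓝 (x, y), p.1 ∉ Z :=
      continuousAt_fst.eventually (hZ.isOpen_compl.mem_nhds hx)
    have h2 : ContinuousAt (fun p : ℝ × ℝ => f p.1) (x, y) :=
      ContinuousAt.comp (f := Prod.fst) (x := (x, y)) (hf x hx) continuousAt_fst
    have h3 : ∀ᶠ p : ℝ × ℝ in 𝓝 (x, y), p.2 ≠ f p.1 := 
      (continuousAt_snd (p := (x, y))).ne_iff_eventually_ne h2 |>.1 hy
    exact h1.and h3
  · exact hZ.isOpen_compl.preimage continuous_fst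
  · exact isClosed_eq continuous_snd continuous_const

/-! ### Connectedness and monotone embeddings -/

/-- If short intervals are connected, then so are all order-connected sets. -/
theorem isPreconnected_of_eventually_uIcc {f : ℝ → ℝ}
    (h : ∀ x : ℝ, ∀ᶠ y in 𝓝 x, @IsPreconnected ℝ (graphTopology f) (uIcc x y)) {s : Set ℝ} (hs : s.OrdConnected) :
    @IsPreconnected ℝ (graphTopology f) s := by
  refine @isPreconnected_of_forall_constant ℝ (graphTopology f) s fun g hg x hx y hy => ?_
  refine hs.isPreconnected.induction₂ (fun a b => g a = g b) (fun a ha => ?_)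
    (fun a b c _ _ _ => Eq.trans) (fun a b _ _ => Eq.symm) hx hy
  filter_upwards [(h a).filter_mono nhdsWithin_le_nhds, self_mem_nhdsWithin] with b hb hbs
  exact @IsPreconnected.constant ℝ (graphTopology f) Bool _ _ _ hb g
    (@ContinuousOn.mono ℝ Bool (graphTopology f) _ _ _ _ hg (hs.uIcc_subset ha hbs)) a b
    left_mem_uIcc right_mem_uIcc

theorem isPreconnected_graphTopology_of_continuousOn {f : ℝ → ℝ} {s : Set ℝ}
    (hs : s.OrdConnected) (hf : ContinuousOn f s) : @IsPreconnected ℝ (graphTopology f) s := by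
  rw [← @IsInducing.isPreconnected_image ℝ (ℝ × ℝ) (graphTopology f) _ _ _
    (isInducing_graphTopology f)]
  exact hs.isPreconnected.image _ (continuousOn_id.prodMk hf)

/-- An injective function with the intermediate value property is strictly monotone. -/
theorem strictMono_or_strictAnti_of_ordConnected_image {h : ℝ → ℝ} (hinj : Function.Injective h)
    (himg : ∀ s : Set ℝ, s.OrdConnected → (h '' s).OrdConnected) :
    StrictMono h ∨ StrictAnti h := by
  by_cases hm : Monotone h
  · exact Or.inl (hm.strictMono_of_injective hinj)
  by_cases ha : Antitone h
  · exact Or.inr (ha.strictAnti_of_injective hinj)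
  exfalso
  -- As `h b` is extremal, whichever of `h a`, `h c` is closer to it is taken again on the other
  -- side of `b`.
  obtain ⟨a, b, c, hab, hbc, H⟩ := not_monotone_not_antitone_iff_exists_lt_lt.1 ⟨hm, ha⟩
  have key1 : h c ∉ h '' Icc a b := by
    rintro ⟨d, hd, hdc⟩
    have := hinj hdc
    linarith [hd.2]
  have key2 : h a ∉ h '' Icc b c := by
    rintro ⟨d, hd, hdc⟩
    have := hinj hdc
    linarith [hd.1]
  have o1 := himg _ (ordConnected_Icc (a := a) (b := b))
  have o2 := himg _ (ordConnected_Icc (a := b) (b := c))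
  have ma : h a ∈ h '' Icc a b := mem_image_of_mem _ (left_mem_Icc.2 hab.le)
  have mb : h b ∈ h '' Icc a b := mem_image_of_mem _ (right_mem_Icc.2 hab.le)
  have mb2 : h b ∈ h '' Icc b c := mem_image_of_mem _ (left_mem_Icc.2 hbc.le)
  have mc : h c ∈ h '' Icc b c := mem_image_of_mem _ (right_mem_Icc.2 hbc.le)
  rcases H with ⟨h1, h2⟩ | ⟨h1, h2⟩ <;> rcases le_total (h a) (h c) with h3 | h3
  · exact key1 (o1.out ma mb ⟨h3, h2.le⟩)
  · exact key2 (o2.out mc mb2 ⟨h3, h1.le⟩)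
  · exact key2 (o2.out mb2 mc ⟨h1.le, h3⟩)
  · exact key1 (o1.out mb ma ⟨h2.le, h3⟩)

theorem StrictMono.isOpenEmbedding_of_ordConnected_range {h : ℝ → ℝ} (hm : StrictMono h)
    (hr : (range h).OrdConnected) : IsOpenEmbedding h := by
  refine ⟨hm.isEmbedding_of_ordConnected hr, isOpen_iff_mem_nhds.2 ?_⟩
  rintro _ ⟨x, rfl⟩
  exact mem_of_superset (Ioo_mem_nhds (hm (sub_one_lt x)) (hm (lt_add_one x)))
    (Ioo_subset_Icc_self.trans (hr.out (mem_range_self _) (mem_range_self _)))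

/-- `h` embeds `(ℝ, graphTopology f)` into `(ℝ, graphTopology g)` and is an embedding of the
Euclidean line: relative continuity of `f` at `x` corresponds to that of `g` at `h x`. -/
theorem tendsto_nhdsWithin_iff_of_graphTopology_eq_induced {f g h : ℝ → ℝ}
    (hfg : graphTopology f = TopologicalSpace.induced h (graphTopology g))
    (ho : IsOpenEmbedding h) (x : ℝ) (s : Set ℝ) :
    Tendsto f (𝓝[h ⁻¹' s] x) (𝓝 (f x)) ↔ Tendsto g (𝓝[s] (h x)) (𝓝 (g (h x))) := by
  have e : @nhds ℝ (graphTopology f) x = comap h (@nhds ℝ (graphTopology g) (h x)) := by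
    rw [hfg, @nhds_induced ℝ ℝ (graphTopology g) h x]
  have A : Tendsto f (𝓝[h ⁻¹' s] x) (𝓝 (f x)) ↔
      Tendsto id (𝓝[h ⁻¹' s] x) (@nhds ℝ (graphTopology f) x) := by
    rw [tendsto_nhds_graphTopology]
    exact ⟨fun H => ⟨tendsto_id.mono_left nhdsWithin_le_nhds, H⟩, fun H => H.2⟩
  rw [A, e, tendsto_comap_iff, ← ho.map_nhdsWithin_preimage_eq, tendsto_map'_iff,
    Function.comp_id, tendsto_nhds_graphTopology]
  exact ⟨fun H => H.2, fun H => ⟨ho.continuous.continuousAt.mono_left nhdsWithin_le_nhds, H⟩⟩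

/-! ### The oscillating function -/

open Real in
/-- A function vanishing on `ℤ` and continuous off `ℤ`, which oscillates to the right of the
points of `P` and to the left of the points of `Q`. -/
noncomputable def sineComb (P Q : Set ℤ) (x : ℝ) : ℝ :=
  -- Each damping factor kills its term at the opposite end of the unit interval. At integers `π / 0
  -- = 0` makes the value `0`.
  P.indicator 1 ⌊x⌋ * ((1 - Int.fract x) * sin (π / Int.fract x)) +
    Q.indicator 1 (⌊x⌋ + 1) * (Int.fract x * sin (π / (1 - Int.fract x)))

namespace sineComb

variable {P Q : Set ℤ}

open Real in
theorem add_eq (n : ℤ) {u : ℝ} (h0 : 0 ≤ u) (h1 : u < 1) :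
    sineComb P Q (n + u) = P.indicator 1 n * ((1 - u) * sin (π / u)) +
      Q.indicator 1 (n + 1) * (u * sin (π / (1 - u))) := by
  have hf : ⌊(n + u : ℝ)⌋ = n := by
    rw [Int.floor_eq_iff]
    constructor <;> linarith
  have hu : Int.fract (n + u : ℝ) = u := by
    rw [Int.fract, hf]; ring
  rw [sineComb, hf, hu]

theorem intCast (n : ℤ) : sineComb P Q n = 0 := by
  simpa using add_eq (P := P) (Q := Q) n le_rfl one_pos

/-- Reflection swaps the two sides, so left-hand facts follow from right-hand ones. -/
theorem neg (x : ℝ) : sineComb P Q (-x) = sineComb (Neg.neg ⁻¹' Q) (Neg.neg ⁻¹' P) x := by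
  obtain ⟨n, u, h0, h1, rfl⟩ : ∃ (n : ℤ) (u : ℝ), 0 ≤ u ∧ u < 1 ∧ x = n + u :=
    ⟨⌊x⌋, Int.fract x, Int.fract_nonneg x, Int.fract_lt_one x, (Int.floor_add_fract x).symm⟩
  rcases h0.eq_or_lt with rfl | h0'
  · have h : -((n : ℝ) + 0) = ((-n : ℤ) : ℝ) := by push_cast; ring
    rw [h, intCast, add_zero, intCast]
  · have h : -((n : ℝ) + u) = ((-n - 1 : ℤ) : ℝ) + (1 - u) := by push_cast; ring
    rw [h, add_eq _ (by linarith) (by linarith), add_eq _ h0 h1]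
    have hi : ∀ (R : Set ℤ) (m : ℤ), (Neg.neg ⁻¹' R).indicator (1 : ℤ → ℝ) m = R.indicator 1 (-m) :=
      fun R m => rfl
    rw [hi, hi, sub_sub_cancel, sub_add_cancel, neg_add', add_comm]

theorem continuousAt {x : ℝ} (hx : x ∉ range ((↑) : ℤ → ℝ)) : ContinuousAt (sineComb P Q) x := by
  have hl : (⌊x⌋ : ℝ) < x := lt_of_le_of_ne (Int.floor_le x) fun h => hx ⟨_, h⟩
  have hr : x < ⌊x⌋ + 1 := Int.lt_floor_add_one x
  have he : (fun y : ℝ => P.indicator 1 ⌊x⌋ * ((1 - (y - ⌊x⌋)) * Real.sin (Real.pi / (y - ⌊x⌋))) +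
      Q.indicator 1 (⌊x⌋ + 1) * ((y - ⌊x⌋) * Real.sin (Real.pi / (1 - (y - ⌊x⌋)))))
      =ᶠ[𝓝 x] sineComb P Q := by
    filter_upwards [Ioo_mem_nhds hl hr] with y hy
    have := add_eq (P := P) (Q := Q) ⌊x⌋ (u := y - ⌊x⌋) (by linarith [hy.1]) (by linarith [hy.2])
    rw [add_sub_cancel] at this
    exact this.symm
  refine ContinuousAt.congr ?_ he
  have h1 : x - ⌊x⌋ ≠ 0 := by linarith
  have h2 : 1 - (x - ⌊x⌋) ≠ 0 := by linarith
  fun_prop (disch := assumption)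

theorem isClosed_range_intCast : IsClosed (range ((↑) : ℤ → ℝ)) :=
  Int.isClosedEmbedding_coe_real.isClosed_range

theorem polishSpace : @PolishSpace ℝ (graphTopology (sineComb P Q)) := by
  refine polishSpace_graphTopology (isGδ_range_graph isClosed_range_intCast ?_ fun x => continuousAt)
  rintro _ ⟨n, rfl⟩
  exact intCast n

/-- Behaviour along sequences to the right of `n` on which `sin (π / u)` takes the value `s`. -/
theorem tendsto_right_seq (n : ℤ) {u : ℕ → ℝ} {s : ℝ} (h0 : ∀ k, 0 < u k) (h1 : ∀ k, u k < 1)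
    (hu : Tendsto u atTop (𝓝 0)) (hs : ∀ k, Real.sin (Real.pi / u k) = s) :
    Tendsto (fun k => sineComb P Q (n + u k)) atTop (𝓝 (P.indicator 1 n * s)) := by
  have he : ∀ k, sineComb P Q (n + u k) = P.indicator 1 n * ((1 - u k) * s) +
      Q.indicator 1 (n + 1) * (u k * Real.sin (Real.pi / (1 - u k))) := fun k => by
    rw [add_eq n (h0 k).le (h1 k), hs]
  simp only [he]
  have hc : ContinuousAt (fun v : ℝ => P.indicator 1 n * ((1 - v) * s) +
      Q.indicator 1 (n + 1) * (v * Real.sin (Real.pi / (1 - v)))) 0 := by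
    have : (1 : ℝ) - 0 ≠ 0 := by norm_num
    fun_prop (disch := assumption)
  simpa [Function.comp_def] using hc.tendsto.comp hu

theorem tendsto_one_div_affine {c d : ℝ} (hc : 0 < c) :
    Tendsto (fun k : ℕ => 1 / (c * k + d)) atTop (𝓝 0) :=
  tendsto_const_nhds.div_atTop
    (tendsto_atTop_add_const_right _ _ (tendsto_natCast_atTop_atTop.const_mul_atTop hc))

/-- `sineComb P Q` is continuous from the right exactly at the integers outside `P`. -/
theorem tendsto_right_iff (n : ℤ) :
    Tendsto (sineComb P Q) (𝓝[>] (n : ℝ)) (𝓝 0) ↔ n ∉ P := by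
  constructor
  · intro h hn
    -- Peaks of `sin (π / u)`; `5 / 2` instead of `1 / 2` keeps `u < 1`.
    have h0 : ∀ k : ℕ, (0 : ℝ) < 1 / (2 * k + 5 / 2) := fun k => by positivity
    have hu := tendsto_one_div_affine (c := 2) (d := 5 / 2) two_pos
    have h2 := tendsto_right_seq (P := P) (Q := Q) n (s := 1) h0 (fun k => by
      rw [div_lt_one (by positivity)]
      have : (0 : ℝ) ≤ k := by positivity
      linarith) hu (fun k => by
      have e : Real.pi / (1 / (2 * k + 5 / 2)) = Real.pi / 2 + (k + 1 : ℕ) * (2 * Real.pi) := by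
        push_cast
        field_simp
        ring
      rw [e, Real.sin_add_nat_mul_two_pi, Real.sin_pi_div_two])
    have h3 : Tendsto (fun k : ℕ => (n : ℝ) + 1 / (2 * k + 5 / 2)) atTop (𝓝[>] (n : ℝ)) := by
      refine tendsto_nhdsWithin_iff.2 ⟨by simpa using hu.const_add (n : ℝ), .of_forall fun k => ?_⟩
      have := h0 k
      simpa using this
    have := tendsto_nhds_unique h2 (h.comp h3)
    simp [hn] at this
  · intro hn
    have hc : ContinuousAt (fun v : ℝ => Q.indicator 1 (n + 1) *
        ((v - n) * Real.sin (Real.pi / (1 - (v - n))))) n := by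
      have : (1 : ℝ) - (n - n) ≠ 0 := by norm_num
      fun_prop (disch := assumption)
    have ht : Tendsto (fun v : ℝ => Q.indicator 1 (n + 1) *
        ((v - n) * Real.sin (Real.pi / (1 - (v - n))))) (𝓝[>] (n : ℝ)) (𝓝 0) := by
      simpa using hc.tendsto.mono_left nhdsWithin_le_nhds
    refine ht.congr' ?_
    filter_upwards [Ioo_mem_nhdsGT (lt_add_one (n : ℝ))] with y hy
    have := add_eq (P := P) (Q := Q) n (u := y - n) (by linarith [hy.1]) (by linarith [hy.2])
    rw [add_sub_cancel] at this
    rw [this]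
    simp [hn]

theorem tendsto_left_iff (n : ℤ) :
    Tendsto (sineComb P Q) (𝓝[<] (n : ℝ)) (𝓝 0) ↔ n ∉ Q := by
  have h := tendsto_right_iff (P := Neg.neg ⁻¹' Q) (Q := Neg.neg ⁻¹' P) (-n)
  rw [mem_preimage, neg_neg] at h
  rw [← h]
  have e : sineComb (Neg.neg ⁻¹' Q) (Neg.neg ⁻¹' P) = sineComb P Q ∘ Neg.neg :=
    funext fun x => (neg x).symm
  rw [e, ← tendsto_map'_iff, Int.cast_neg]
  have : map Neg.neg (𝓝[>] (-(n : ℝ))) = 𝓝[<] (n : ℝ) := by simp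
  rw [this]

/-- Every integer lies in the closure of an adjacent open interval on its right. -/
theorem mem_closure_Ioc (n : ℤ) {y : ℝ} (hy : (n : ℝ) < y) :
    (n : ℝ) ∈ @closure ℝ (graphTopology (sineComb P Q)) (Ioc (n : ℝ) y) := by
  -- Zeros of `sin (π / u)`: along them the function tends to its value `0` at `n`.
  have h0 : ∀ k : ℕ, (0 : ℝ) < 1 / (1 * k + 2) := fun k => by positivity
  have hu := tendsto_one_div_affine (c := 1) (d := 2) one_pos
  have h2 := tendsto_right_seq (P := P) (Q := Q) n (s := 0) h0 (fun k => by
      rw [div_lt_one (by positivity)]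
      have : (0 : ℝ) ≤ k := by positivity
      linarith) hu (fun k => by
      rw [← Real.sin_nat_mul_pi (k + 2)]
      congr 1
      push_cast
      field_simp)
  have h3 : Tendsto (fun k : ℕ => (n : ℝ) + 1 / (1 * k + 2)) atTop (𝓝 (n : ℝ)) := by
    simpa using hu.const_add (n : ℝ)
  refine @mem_closure_of_tendsto ℝ (graphTopology (sineComb P Q)) ℕ _ _ _ atTop _
    (tendsto_nhds_graphTopology.2 ⟨h3, ?_⟩) ?_
  · rw [intCast]
    simpa using h2
  · filter_upwards [h3.eventually_le_const hy] with k hk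
    exact ⟨by simpa using h0 k, hk⟩

end sineComb

/-! ### Connectedness and embeddings of the comb topologies -/

namespace sineComb

variable {P Q : Set ℤ}

theorem isPreconnected_Icc_intCast (n : ℤ) {y : ℝ} (hy : (n : ℝ) < y) (hy' : y < n + 1) :
    @IsPreconnected ℝ (graphTopology (sineComb P Q)) (Icc (n : ℝ) y) := by
  have h1 : @IsPreconnected ℝ (graphTopology (sineComb P Q)) (Ioc (n : ℝ) y) := by
    refine isPreconnected_graphTopology_of_continuousOn ordConnected_Ioc fun x hx => ?_
    refine (continuousAt ?_).continuousWithinAt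
    rintro ⟨m, rfl⟩
    have h1 : n < m := by exact_mod_cast hx.1
    have h2 : m < n + 1 := by exact_mod_cast hx.2.trans_lt hy'
    omega
  refine @IsPreconnected.subset_closure ℝ (graphTopology (sineComb P Q)) _ _ h1
    Ioc_subset_Icc_self ?_
  rw [← Ioc_insert_left hy.le]
  exact insert_subset (mem_closure_Ioc n hy) (@subset_closure ℝ (graphTopology (sineComb P Q)) _)

/-- Negation is a homeomorphism between the topologies of `sineComb P Q` and its reflection. -/
theorem graphTopology_neg :
    graphTopology (sineComb (Neg.neg ⁻¹' Q) (Neg.neg ⁻¹' P)) =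
      TopologicalSpace.induced Neg.neg (graphTopology (sineComb P Q)) := by
  refine TopologicalSpace.ext_nhds fun x => ?_
  have e : (sineComb (Neg.neg ⁻¹' Q) (Neg.neg ⁻¹' P)) = sineComb P Q ∘ Neg.neg :=
    funext fun x => (neg x).symm
  rw [@nhds_induced ℝ ℝ (graphTopology (sineComb P Q)), nhds_graphTopology, nhds_graphTopology, e,
    comap_inf, comap_comap]
  congr 1
  simpa using ((Homeomorph.neg ℝ).comap_nhds_eq (-x)).symm

theorem isPreconnected {s : Set ℝ} (hs : s.OrdConnected) :
    @IsPreconnected ℝ (graphTopology (sineComb P Q)) s := by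
  refine isPreconnected_of_eventually_uIcc (fun x => ?_) hs
  by_cases hx : x ∈ range ((↑) : ℤ → ℝ)
  · obtain ⟨n, rfl⟩ := hx
    filter_upwards [Ioo_mem_nhds (sub_one_lt (n : ℝ)) (lt_add_one (n : ℝ))] with y hy
    rcases lt_trichotomy (n : ℝ) y with h | rfl | h
    · rw [uIcc_of_le h.le]
      exact isPreconnected_Icc_intCast n h hy.2
    · rw [uIcc_self]
      exact @isPreconnected_singleton ℝ (graphTopology (sineComb P Q)) _
    · rw [uIcc_of_ge h.le]
      have h1 := isPreconnected_Icc_intCast (P := Neg.neg ⁻¹' Q) (Q := Neg.neg ⁻¹' P) (-n) (y := -y)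
        (by push_cast; linarith) (by push_cast; linarith [hy.1])
      have h2 : Icc y n = Neg.neg '' Icc ((-n : ℤ) : ℝ) (-y) := by simp
      rw [h2]
      refine @IsPreconnected.image ℝ ℝ (graphTopology _) (graphTopology _) _ h1 _ ?_
      refine @Continuous.continuousOn ℝ ℝ (graphTopology _) (graphTopology _) _ _ ?_
      rw [graphTopology_neg]
      exact continuous_induced_dom
  · have : ∀ᶠ y in 𝓝 x, y ∉ range ((↑) : ℤ → ℝ) := isClosed_range_intCast.isOpen_compl.mem_nhds hx
    obtain ⟨ε, hε, hb⟩ := Metric.eventually_nhds_iff_ball.1 this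
    filter_upwards [Metric.ball_mem_nhds x hε] with y hy
    refine isPreconnected_graphTopology_of_continuousOn ordConnected_uIcc fun z hz => ?_
    refine (continuousAt (hb z ?_)).continuousWithinAt
    exact ((convex_ball x ε).ordConnected.uIcc_subset (Metric.mem_ball_self hε) hy) hz

theorem connectedSpace : @ConnectedSpace ℝ (graphTopology (sineComb P Q)) :=
  @ConnectedSpace.mk ℝ (graphTopology (sineComb P Q))
    (@PreconnectedSpace.mk ℝ (graphTopology (sineComb P Q)) (isPreconnected ordConnected_univ)) ⟨0⟩

/-- An embedding between two topologies `graphTopology (sineComb P Q)` is strictly monotone or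
strictly antitone, with order-connected range. -/
theorem strictMono_or_strictAnti {g h : ℝ → ℝ} (hinj : Function.Injective h)
    (he : graphTopology (sineComb P Q) = TopologicalSpace.induced h (graphTopology g)) :
    (StrictMono h ∨ StrictAnti h) ∧ (range h).OrdConnected := by
  have hc : @Continuous ℝ ℝ (graphTopology (sineComb P Q)) _ h := by
    rw [continuous_iff_le_induced, he]
    exact induced_mono (graphTopology_le g)
  -- Intervals are connected in the fine source topology, and `h` is continuous into the Euclidean
  -- line.
  have himg : ∀ s : Set ℝ, s.OrdConnected → (h '' s).OrdConnected := fun s hs =>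
    (@IsPreconnected.image ℝ ℝ (graphTopology (sineComb P Q)) _ _ (isPreconnected hs) h
      (@Continuous.continuousOn ℝ ℝ (graphTopology (sineComb P Q)) _ _ _ hc)).ordConnected
  refine ⟨strictMono_or_strictAnti_of_ordConnected_image hinj himg, ?_⟩
  rw [← image_univ]
  exact himg _ ordConnected_univ

/-- A strictly monotone embedding is surjective and shifts the marked integers. -/
theorem exists_shift_of_strictMono {P' Q' : Set ℤ} (hPQ : P ∪ Q = univ) (hPQ' : P' ∪ Q' = univ)
    {h : ℝ → ℝ} (hm : StrictMono h) (hr : (range h).OrdConnected)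
    (he : graphTopology (sineComb P Q) =
      TopologicalSpace.induced h (graphTopology (sineComb P' Q'))) :
    Function.Surjective h ∧ ∃ c : ℤ, ∀ n, (n ∈ P ↔ n + c ∈ P') ∧ (n ∈ Q ↔ n + c ∈ Q') := by
  have ho := hm.isOpenEmbedding_of_ordConnected_range hr
  have hIoi : ∀ x, h ⁻¹' Ioi (h x) = Ioi x := fun x => by ext y; exact hm.lt_iff_lt
  have hIio : ∀ x, h ⁻¹' Iio (h x) = Iio x := fun x => by ext y; exact hm.lt_iff_lt
  have tr : ∀ x, Tendsto (sineComb P Q) (𝓝[>] x) (𝓝 (sineComb P Q x)) ↔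
      Tendsto (sineComb P' Q') (𝓝[>] (h x)) (𝓝 (sineComb P' Q' (h x))) := fun x => by
    rw [← tendsto_nhdsWithin_iff_of_graphTopology_eq_induced he ho, hIoi]
  have tl : ∀ x, Tendsto (sineComb P Q) (𝓝[<] x) (𝓝 (sineComb P Q x)) ↔
      Tendsto (sineComb P' Q') (𝓝[<] (h x)) (𝓝 (sineComb P' Q' (h x))) := fun x => by
    rw [← tendsto_nhdsWithin_iff_of_graphTopology_eq_induced he ho, hIio]
  -- Integers are recognised as the points of one-sided discontinuity.
  have key : ∀ {P Q : Set ℤ}, P ∪ Q = univ → ∀ x : ℝ, x ∈ range ((↑) : ℤ → ℝ) ↔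
      ¬ (Tendsto (sineComb P Q) (𝓝[>] x) (𝓝 (sineComb P Q x)) ∧
        Tendsto (sineComb P Q) (𝓝[<] x) (𝓝 (sineComb P Q x))) := fun {P Q} hPQ x => by
    constructor
    · rintro ⟨n, rfl⟩
      rw [intCast, tendsto_right_iff, tendsto_left_iff]
      have : n ∈ P ∪ Q := hPQ ▸ mem_univ n
      rintro ⟨h1, h2⟩
      exact this.elim h1 h2
    · intro hx
      by_contra hx'
      have := (continuousAt (P := P) (Q := Q) hx').tendsto
      exact hx ⟨this.mono_left nhdsWithin_le_nhds, this.mono_left nhdsWithin_le_nhds⟩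
  have hZ : ∀ x, x ∈ range ((↑) : ℤ → ℝ) ↔ h x ∈ range ((↑) : ℤ → ℝ) := fun x => by
    rw [key hPQ, key hPQ', tr, tl]
  choose k hk using fun n : ℤ => (hZ n).1 (mem_range_self n)
  have hkm : StrictMono k := fun a b hab => by
    have := hm (Int.cast_lt (R := ℝ).2 hab)
    rw [← hk, ← hk] at this
    exact_mod_cast this
  have hup : ∀ m : ℕ, k 0 + m ≤ k m := fun m => by
    induction m with
    | zero => simp
    | succ m ih =>
      have := hkm (show (m : ℤ) < (m + 1 : ℕ) by simp)
      push_cast at this ⊢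
      omega
  have hdown : ∀ m : ℕ, k (-m) ≤ k 0 - m := fun m => by
    induction m with
    | zero => simp
    | succ m ih =>
      have := hkm (show (-(m + 1 : ℕ) : ℤ) < -m by simp)
      push_cast at this ⊢
      omega
  -- The order-connected range contains integers `k n` unbounded in both directions.
  have hsurj : Function.Surjective h := fun y => by
    obtain ⟨m, hm1⟩ := exists_nat_ge (y - k 0)
    obtain ⟨l, hl1⟩ := exists_nat_ge (k 0 - y)
    refine hr.out (mem_range_self ((-l : ℤ) : ℝ)) (mem_range_self ((m : ℤ) : ℝ)) ⟨?_, ?_⟩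
    · rw [← hk]
      have : ((k (-l) : ℤ) : ℝ) ≤ ((k 0 - l : ℤ) : ℝ) := Int.cast_le.2 (hdown l)
      push_cast at this
      linarith
    · rw [← hk]
      have : ((k 0 + m : ℤ) : ℝ) ≤ ((k m : ℤ) : ℝ) := Int.cast_le.2 (hup m)
      push_cast at this
      linarith
  have hksurj : Function.Surjective k := fun z => by
    obtain ⟨x, hx⟩ := hsurj z
    obtain ⟨n, rfl⟩ := (hZ x).2 (hx ▸ mem_range_self z)
    exact ⟨n, by exact_mod_cast (hk n).trans hx⟩
  -- An increasing bijection of `ℤ` cannot skip a value.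
  have hstep : ∀ n, k (n + 1) = k n + 1 := fun n => by
    obtain ⟨m, hm1⟩ := hksurj (k n + 1)
    have h1 : n < m := hkm.lt_iff_lt.1 (by omega)
    have h2 : k (n + 1) ≤ k m := hkm.monotone (by omega)
    have h3 := hkm (lt_add_one n)
    omega
  have hform : ∀ n, k n = n + k 0 := fun n => by
    induction n with
    | zero => simp
    | succ m ih => rw [hstep]; omega
    | pred m ih =>
      have := hstep (-m - 1)
      rw [sub_add_cancel] at this
      omega
  refine ⟨hsurj, k 0, fun n => ?_⟩
  have h1 := tr n
  have h2 := tl n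
  rw [← hk, intCast, intCast, tendsto_right_iff, tendsto_right_iff, not_iff_not, hform] at h1
  rw [← hk, intCast, intCast, tendsto_left_iff, tendsto_left_iff, not_iff_not, hform] at h2
  exact ⟨h1, h2⟩

end sineComb

/-! ### Coding subsets of `ℕ` by marks -/

/-- The integers at which the topology coded by `A` is singular from the right. -/
def rightMarks (A : Set ℕ) : Set ℤ := {n | n ≤ 1} ∪ (fun k : ℕ => (k : ℤ) + 2) '' A

/-- The integers at which the topology coded by `A` is singular from the left. -/
def leftMarks (A : Set ℕ) : Set ℤ := {0} ∪ (fun k : ℕ => (k : ℤ) + 2) '' Aᶜ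

theorem add_two_mem_rightMarks {A : Set ℕ} {k : ℕ} : (k : ℤ) + 2 ∈ rightMarks A ↔ k ∈ A := by
  have : ¬ (k : ℤ) + 2 ≤ 1 := by omega
  simp [rightMarks, this]

theorem mem_rightMarks_of_le_one {A : Set ℕ} {n : ℤ} (hn : n ≤ 1) : n ∈ rightMarks A := Or.inl hn

theorem mem_leftMarks_of_le_one {A : Set ℕ} {n : ℤ} (hn : n ≤ 1) : n ∈ leftMarks A ↔ n = 0 := by
  simp only [leftMarks, mem_union, mem_singleton_iff, mem_image, or_iff_left_iff_imp]
  rintro ⟨k, -, rfl⟩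
  omega

/-- The only doubly marked integer is the anchor that excludes nonzero shifts. -/
theorem mem_marks_iff {A : Set ℕ} {n : ℤ} : n ∈ rightMarks A ∧ n ∈ leftMarks A ↔ n = 0 := by
  rcases le_or_gt n 1 with h | h
  · simp [mem_rightMarks_of_le_one h, mem_leftMarks_of_le_one h]
  · obtain ⟨k, rfl⟩ : ∃ k : ℕ, n = k + 2 := ⟨(n - 2).toNat, by omega⟩
    have : (k : ℤ) + 2 ≠ 0 := by omega
    simp [add_two_mem_rightMarks, leftMarks, this]

theorem rightMarks_union_leftMarks (A : Set ℕ) : rightMarks A ∪ leftMarks A = univ := by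
  refine eq_univ_of_forall fun n => ?_
  rcases le_or_gt n 1 with h | h
  · exact Or.inl (mem_rightMarks_of_le_one h)
  · obtain ⟨k, rfl⟩ : ∃ k : ℕ, n = k + 2 := ⟨(n - 2).toNat, by omega⟩
    by_cases hk : k ∈ A
    · exact Or.inl (add_two_mem_rightMarks.2 hk)
    · exact Or.inr (Or.inr (mem_image_of_mem _ hk))

/-- The topology on `ℝ` coded by `A`. -/
noncomputable abbrev codedTopology (A : Set ℕ) : TopologicalSpace ℝ :=
  graphTopology (sineComb (rightMarks A) (leftMarks A))

theorem codedTopology_rigid {A B : Set ℕ} {h : ℝ → ℝ} (hinj : Function.Injective h)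
    (he : codedTopology A = TopologicalSpace.induced h (codedTopology B)) :
    A = B ∧ Function.Surjective h := by
  obtain ⟨hm | ha, hr⟩ := sineComb.strictMono_or_strictAnti hinj he
  · obtain ⟨hs, c, hc⟩ := sineComb.exists_shift_of_strictMono (rightMarks_union_leftMarks A)
      (rightMarks_union_leftMarks B) hm hr he
    have h0 : c = 0 := by
      have := (mem_marks_iff (A := A)).2 (rfl : (0 : ℤ) = 0)
      rw [(hc 0).1, (hc 0).2, mem_marks_iff] at this
      simpa using this
    subst h0
    refine ⟨Set.ext fun k => ?_, hs⟩
    simpa [add_two_mem_rightMarks] using (hc (k + 2)).1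
  · exfalso
    have hm : StrictMono (h ∘ Neg.neg) := fun x y hxy => ha (neg_lt_neg hxy)
    have hr' : (range (h ∘ Neg.neg)).OrdConnected := by
      rwa [neg_surjective.range_comp]
    have he' := (sineComb.graphTopology_neg (P := rightMarks A) (Q := leftMarks A)).trans
      ((congrArg (TopologicalSpace.induced Neg.neg) he).trans
        (@induced_compose ℝ ℝ ℝ (codedTopology B) Neg.neg h))
    obtain ⟨-, c, hc⟩ := sineComb.exists_shift_of_strictMono
      (by rw [← preimage_union, union_comm, rightMarks_union_leftMarks, preimage_univ])
      (rightMarks_union_leftMarks B) hm hr' he'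
    have h0 : c = 0 := by
      have := (mem_marks_iff (A := A)).2 (neg_zero : -(0 : ℤ) = 0)
      have h1 := (hc 0).1.1 this.2
      have h2 := (hc 0).2.1 this.1
      simpa using mem_marks_iff.1 ⟨h1, h2⟩
    subst h0
    -- A reversal would turn the right mark at `-1` into a left mark at `1`, which no code has.
    have h1 := (hc 1).2.1 (mem_rightMarks_of_le_one (by norm_num : -(1 : ℤ) ≤ 1))
    rw [add_zero, mem_leftMarks_of_le_one le_rfl] at h1
    exact one_ne_zero h1

theorem codedTopology_injective : Function.Injective codedTopology := fun A B h =>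
  (codedTopology_rigid Function.injective_id (h.trans (@induced_id ℝ (codedTopology B)).symm)).1

/-! ### The family of topologies -/

theorem corollary2 :
    ∃ T : Set (TopologicalSpace ℝ),
      Cardinal.mk T = Cardinal.continuum ∧
      (∀ τ ∈ T,
        τ ≤ euclideanTopology ∧
        @ConnectedSpace ℝ τ ∧
        @TopologicalSpace.SeparableSpace ℝ τ ∧
        @TopologicalSpace.IsCompletelyMetrizableSpace ℝ τ) ∧
      IncomparableTopologies T := by
  refine ⟨range codedTopology, ?_, ?_, ?_⟩
  · rw [Cardinal.mk_range_eq _ codedTopology_injective, Cardinal.mk_set, Cardinal.mk_nat,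
      Cardinal.two_power_aleph0]
  · rintro _ ⟨A, rfl⟩
    have hp : @PolishSpace ℝ (codedTopology A) := sineComb.polishSpace
    have hs : @SecondCountableTopology ℝ (codedTopology A) :=
      @PolishSpace.toSecondCountableTopology ℝ (codedTopology A) hp
    exact ⟨graphTopology_le _, sineComb.connectedSpace,
      @TopologicalSpace.SecondCountableTopology.to_separableSpace ℝ (codedTopology A) hs,
      @PolishSpace.toIsCompletelyMetrizableSpace ℝ (codedTopology A) hp⟩
  · rintro _ ⟨A, rfl⟩ _ ⟨B, rfl⟩ S ⟨e⟩
    have he : codedTopology A =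
        TopologicalSpace.induced (fun x => (e x : ℝ)) (codedTopology B) := by
      have h1 := @IsInducing.eq_induced _ _ (codedTopology A)
        (TopologicalSpace.induced Subtype.val (codedTopology B)) _
        (@Homeomorph.isInducing _ _ (codedTopology A)
          (TopologicalSpace.induced Subtype.val (codedTopology B)) e)
      rw [@induced_compose ℝ S ℝ (codedTopology B)] at h1
      exact h1
    obtain ⟨h1, h2⟩ := codedTopology_rigid (Subtype.val_injective.comp
      (@Homeomorph.injective _ _ (codedTopology A)
        (TopologicalSpace.induced Subtype.val (codedTopology B)) e)) he
    refine ⟨congrArg _ h1, eq_univ_of_forall fun y => ?_⟩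
    obtain ⟨x, rfl⟩ := h2 y
    exact (e x).2
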